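/- Let $n\ge 5$ be odd, let $\mathbb F_{2^n}$ be the field with $2^n$ elements, and let $\mathrm{Tr}:\mathbb F_{2^n}\to\mathbb F_2$ be the absolute trace. For $a\in\mathbb F_{2^n}$ put $$K(a)=\sum_{x\in\mathbb F_{2^n}}(-1)^{\mathrm{Tr}(x^{2^n-2}+ax)}\in\mathbb Z,\qquad Q(a)=\sum_{0\le i<j<n}a^{2^i+2^j}.$$ Let $a\in\mathbb F_{2^n}$ with $a\ne 0$. Then $Q(a)\in\{0,1\}$, and $a$ has a unique cube root $a^{1/3}$ in $\mathbb F_{2^n}$. Moreover: (1) If $\mathrm{Tr}(a^{1/3})=0$, then $$K(a)\equiv\begin{cases}4 \pmod{48}&\text{if }\mathrm{Tr}(a)=1,\ Q(a)=1,\\ 16 \pmod{48}&\text{if }\mathrm{Tr}(a)=0,\ Q(a)=0,\\ 28 \pmod{48}&\text{if }\mathrm{Tr}(a)=1,\ Q(a)=0,\\ 40 \pmod{48}&\text{if }\mathrm{Tr}(a)=0,\ Q(a)=1.\end{cases}$$ (2) If $\mathrm{Tr}(a^{1/3})=1$, then there is a unique $\beta\in\mathbb F_{2^n}$ with $\mathrm{Tr}(\beta)=0$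 and $a^{1/3}=\beta^4+\beta+1$. With $\mathrm{Tr}(\beta^3)$ regarded as an integer in $\{0,1\}$, put $m=n+4\,\mathrm{Tr}(\beta^3)$. Then $$K(a)\equiv\begin{cases} 0 \pmod{48}&\text{if }\mathrm{Tr}(a)=0,\ Q(a)=0,\ m\equiv 5,7\pmod 8,\\ 8 \pmod{48}&\text{if }\mathrm{Tr}(a)=0,\ Q(a)=1,\ m\equiv 1,3\pmod 8,\\ 12 \pmod{48}&\text{if }\mathrm{Tr}(a)=1,\ Q(a)=0,\ m\equiv 5,7\pmod 8,\\ 20 \pmod{48}&\text{if }\mathrm{Tr}(a)=1,\ Q(a)=1,\ m\equiv 1,3\pmod 8,\\ 24 \pmod{48}&\text{if }\mathrm{Tr}(a)=0,\ Q(a)=1,\ m\equiv 5,7\pmod 8,\\ 32 \pmod{48}&\text{if }\mathrm{Tr}(a)=0,\ Q(a)=0,\ m\equiv 1,3\pmod 8,\\ 36 \pmod{48}&\text{if }\mathrm{Tr}(a)=1,\ Q(a)=1,\ m\equiv 5,7\pmod 8,\\ 44 \pmod{48}&\text{if }\mathrm{Tr}(a)=1,\ Q(a)=0,\ m\equiv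 1,3\pmod 8. \end{cases}$$ -/

import Mathlib

namespace BinaryKloosterman

/-- The absolute trace map from a finite field of characteristic two to its prime field. -/
noncomputable abbrev Tr {F : Type*} [Field F] [Algebra (ZMod 2) F] (x : F) : ZMod 2 :=
  Algebra.trace (ZMod 2) F x

/-- The quadratic sum `Q(a) = ∑_{0 ≤ i < j < n} a ^ (2 ^ i + 2 ^ j)`, an element of the field. -/
def Q {F : Type*} [Field F] (n : ℕ) (a : F) : F :=
  ∑ j ∈ Finset.range n, ∑ i ∈ Finset.range j, a ^ (2 ^ i + 2 ^ j)

/-- The binary Kloosterman sum `K(a) = ∑_x (-1) ^ Tr(x ^ (2 ^ n - 2) + a x)` over all `x` in the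
field with `2 ^ n` elements (the term `x = 0` is included). -/
noncomputable def K {F : Type*} [Field F] [Fintype F] [Algebra (ZMod 2) F] (n : ℕ) (a : F) : ℤ :=
  ∑ x : F, (-1 : ℤ) ^ (Tr (x ^ (2 ^ n - 2) + a * x)).val

end BinaryKloosterman

/-!
The residue of `K n a` modulo `48` is obtained from its residues modulo `16` and modulo `3`. Write
`q = 2 ^ n` and `chi x = (-1) ^ Tr x`.

*Modulo sixteen.* Expanding `chi = 1 - 2 Tr`, with `Tr` valued in `{0, 1}`, gives `K n a = -q + 4 N`,
where `N = ∑ x, Tr x⁻¹ * Tr (a x)`, so that `N` is needed modulo four. In the Witt vectors of `F` the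
element `T x = ∑_{i < n} [x] ^ (2 ^ i)` lifts the trace, whence `Tr x ≡ T x ^ 2` modulo four, and
`T x ^ 2 = T x + 2 Q̂ x` with `Q̂` the analogous lift of `Q` (`liftTr_sq`, `trInt_eq`). By orthogonality
of the multiplicative characters `x ↦ [x] ^ k` (`sum_teich`), the mixed terms of `N` vanish and
`N ≡ (q - 1) T a ≡ -T a`, that is `K n a ≡ -4 Tr a - 8 Q a` modulo sixteen (`K_modEq_sixteen`).

*Modulo three.* Put `a = c ^ 3`. Up to an elementary term, `K n a` is twice the sum of `chi (a t)` over
the nonzero `t` with `Tr t⁻¹ = 0`, i.e. over `t = x + x⁻¹` with `x` in the field. Cubing `x` is the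
Dickson polynomial `t ↦ t ^ 3 + t`, which permutes this set because `n` is odd. On the complementary
set `Tr t⁻¹ = 1`, where `t = u + u⁻¹` with `u` in a cyclic group of order `q + 1` divisible by three,
its fibres have three elements, apart from the one over `0`. Comparison with the sum over all `t` gives
`K n (c ^ 3) ≡ 1 - S c` modulo three, with `S c = ∑ x, chi (x ^ 3 + c x)` (`K_modEq_three`).

*The cubic sum.* If `Tr c = 0`, the translation `x ↦ x + 1` shows that `S c = 0`. Otherwise
`c = β ^ 4 + β + 1` with `Tr β = 0`, and completing the cube gives `S c = chi (β ^ 3) * S 1`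
(`cubicSum_quartic`). Finally `S 1 = J(2 | n) * 2 ^ ((n + 1) / 2)` (`cubicSum_one`): the square of `S 1`
is `2 q`, and the sign follows by induction on the prime factors `p` of `n`, because the Frobenius
automorphism over the subfield of degree `n / p` has order `p` and its fixed points show that `S 1` has
the same residue modulo `p` for both fields (`cubicSum_one_modEq`).
-/

namespace BinaryKloosterman

/-! ### The additive character -/

section
variable {F : Type*} [Field F] [Algebra (ZMod 2) F]

/-- The canonical additive character `x ↦ (-1) ^ Tr x` of a finite field of characteristic two,
with values in `ℤ`. -/
noncomputable def chi (x : F) : ℤ := (-1) ^ (Tr x).val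

theorem chi_eq (x : F) : chi x = 1 - 2 * ((Tr x).val : ℤ) := by
  unfold chi
  generalize Tr x = u
  decide +revert

theorem chi_of_Tr_eq_zero {x : F} (h : Tr x = 0) : chi x = 1 := by
  simp [chi, h]

theorem chi_of_Tr_eq_one {x : F} (h : Tr x = 1) : chi x = -1 := by
  rw [chi, h]; rfl

theorem chi_zero : chi (0 : F) = 1 := chi_of_Tr_eq_zero (map_zero _)

theorem Tr_eq_zero_or_one (x : F) : Tr x = 0 ∨ Tr x = 1 := by
  generalize Tr x = u
  decide +revert

theorem chi_add (x y : F) : chi (x + y) = chi x * chi y := by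
  unfold chi
  simp only [Tr, map_add]
  generalize Algebra.trace (ZMod 2) F x = u
  generalize Algebra.trace (ZMod 2) F y = v
  decide +revert

theorem charP_two : CharP F 2 :=
  charP_of_injective_algebraMap (algebraMap (ZMod 2) F).injective 2

theorem sq_eq_self_iff (x : F) : x ^ 2 + x = 0 ↔ x = 0 ∨ x = 1 := by
  have : CharP F 2 := charP_two
  rw [show x ^ 2 + x = x * (x + 1) by ring, mul_eq_zero, CharTwo.add_eq_zero]

variable [Fintype F]

theorem Tr_sq (x : F) : Tr (x ^ 2) = Tr x := by
  have h := Algebra.trace_eq_of_algEquiv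
    (FiniteField.frobeniusAlgEquivOfAlgebraic (ZMod 2) F) x
  simpa using h

theorem chi_sq (x : F) : chi (x ^ 2) = chi x := by
  rw [chi, Tr_sq, chi]

theorem finrank_eq {n : ℕ} (hF : Fintype.card F = 2 ^ n) : Module.finrank (ZMod 2) F = n := by
  have h := Module.card_eq_pow_finrank (K := ZMod 2) (V := F)
  rw [hF, ZMod.card] at h
  exact (Nat.pow_right_injective le_rfl h).symm

theorem Tr_one {n : ℕ} (hn : Odd n) (hF : Fintype.card F = 2 ^ n) : Tr (1 : F) = 1 := by
  have h := Algebra.trace_algebraMap (S := F) (1 : ZMod 2)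
  rw [map_one, finrank_eq hF, nsmul_eq_mul, mul_one] at h
  rw [Tr, h]
  exact (ZMod.natCast_eq_one_iff_odd).2 hn

theorem sum_chi : ∑ x : F, chi x = 0 := by
  obtain ⟨b, hb⟩ := Algebra.trace_surjective (ZMod 2) F 1
  have h : ∑ x : F, chi x = ∑ x : F, chi (x + b) :=
    (Equiv.sum_comp (Equiv.addRight b) chi).symm
  simp only [chi_add, chi_of_Tr_eq_one hb, mul_neg_one, Finset.sum_neg_distrib] at h
  omega

theorem sum_chi_mul {b : F} (hb : b ≠ 0) : ∑ x : F, chi (b * x) = 0 := by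
  rw [← sum_chi (F := F)]
  exact Equiv.sum_comp (Equiv.mulLeft₀ b hb) chi

theorem sum_chi_inv : ∑ x : F, chi x⁻¹ = 0 := by
  rw [← sum_chi (F := F)]
  exact Equiv.sum_comp (Equiv.inv F) chi

/-- The Kloosterman sum with the monomial `x ^ (2 ^ n - 2)` read as inversion, `0⁻¹` being `0`. -/
theorem K_eq_sum_inv {n : ℕ} (hn : 2 ≤ n) (hF : Fintype.card F = 2 ^ n) (a : F) :
    K n a = ∑ x : F, chi x⁻¹ * chi (a * x) := by
  refine Finset.sum_congr rfl fun x _ => ?_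
  rw [← chi_add, chi]
  have h4 : 2 ^ 2 ≤ 2 ^ n := Nat.pow_le_pow_right (by norm_num) hn
  congr 4
  rcases eq_or_ne x 0 with rfl | hx
  · rw [inv_zero, zero_pow (by omega)]
  · refine eq_inv_of_mul_eq_one_left ?_
    rw [← pow_succ, ← FiniteField.pow_card_sub_one_eq_one x hx, hF]
    congr 1
    omega

/-! ### Artin–Schreier equations -/

/-- The map `y ↦ y ^ 2 + y`, as a linear map over the prime field. -/
def artinSchreier : F →ₗ[ZMod 2] F where
  toFun y := y ^ 2 + y
  map_add' x y := by
    have : CharP F 2 := charP_two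
    rw [CharTwo.add_sq]; ring
  map_smul' u x := by
    have hu : u ^ 2 = u := by fin_cases u <;> rfl
    simp only [RingHom.id_apply, smul_pow, hu, smul_add]

theorem Tr_artinSchreier (y : F) : Tr (y ^ 2 + y) = 0 := by
  have h := Tr_sq y
  simp only [Tr, map_add] at h ⊢
  rw [h, CharTwo.add_self_eq_zero]

/-- Both sides are hyperplanes: the kernel of `y ↦ y ^ 2 + y` is the prime field, and the range
lies in the kernel of the trace. -/
theorem exists_sq_add_self {u : F} (hu : Tr u = 0) : ∃ y : F, y ^ 2 + y = u := by
  have hle : LinearMap.range (artinSchreier (F := F)) ≤ LinearMap.ker (Algebra.trace (ZMod 2) F) := by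
    rintro _ ⟨y, rfl⟩
    exact Tr_artinSchreier y
  have hker : Module.finrank (ZMod 2) (LinearMap.ker (artinSchreier (F := F))) ≤ 1 := by
    refine finrank_le_one ⟨1, (sq_eq_self_iff _).2 (Or.inr rfl)⟩ ?_
    rintro ⟨x, hx⟩
    rcases (sq_eq_self_iff x).1 hx with rfl | rfl
    · exact ⟨0, by ext; simp⟩
    · exact ⟨1, by ext; simp⟩
  have h1 := LinearMap.finrank_range_add_finrank_ker (artinSchreier (F := F))
  have h2 := LinearMap.finrank_range_add_finrank_ker (Algebra.trace (ZMod 2) F)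
  rw [LinearMap.range_eq_top.2 (Algebra.trace_surjective (ZMod 2) F), finrank_top,
    Module.finrank_self] at h2
  have heq := Submodule.eq_of_le_of_finrank_le hle (by omega)
  have hmem : u ∈ LinearMap.ker (Algebra.trace (ZMod 2) F) := hu
  rw [← heq] at hmem
  exact hmem

theorem exists_sq_add_self_Tr_eq_zero {n : ℕ} (hn : Odd n) (hF : Fintype.card F = 2 ^ n) {u : F}
    (hu : Tr u = 0) : ∃ y : F, Tr y = 0 ∧ y ^ 2 + y = u := by
  have : CharP F 2 := charP_two
  obtain ⟨y, hy⟩ := exists_sq_add_self hu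
  rcases Tr_eq_zero_or_one y with h | h
  · exact ⟨y, h, hy⟩
  · refine ⟨y + 1, ?_, ?_⟩
    · have h1 := Tr_one hn hF
      simp only [Tr, map_add] at h h1 ⊢
      rw [h, h1]; rfl
    · rw [CharTwo.add_sq, ← hy]
      linear_combination CharTwo.two_eq_zero (R := F)

/-- Since `β ^ 4 + β` is the square of `y ↦ y ^ 2 + y` under composition, two Artin–Schreier
equations are solved in turn, each in the hyperplane of trace zero. -/
theorem existsUnique_quartic {n : ℕ} (hn : Odd n) (hF : Fintype.card F = 2 ^ n) {c : F}
    (hc : Tr c = 1) : ∃! β : F, Tr β = 0 ∧ c = β ^ 4 + β + 1 := by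
  have : CharP F 2 := charP_two
  have h1 := Tr_one hn hF
  have h2 : (2 : F) = 0 := CharTwo.two_eq_zero
  have hinj : ∀ z : F, Tr z = 0 → z ^ 2 + z = 0 → z = 0 := by
    intro z hz h
    rcases (sq_eq_self_iff z).1 h with h | h
    · exact h
    · rw [h, h1] at hz
      exact absurd hz one_ne_zero
  have hc' : Tr (c + 1) = 0 := by
    simp only [Tr, map_add] at hc h1 ⊢
    rw [hc, h1]; rfl
  obtain ⟨y, hy, hyc⟩ := exists_sq_add_self_Tr_eq_zero hn hF hc'
  obtain ⟨b, hb, hby⟩ := exists_sq_add_self_Tr_eq_zero hn hF hy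
  refine ⟨b, ⟨hb, ?_⟩, ?_⟩
  · subst hby
    linear_combination -hyc + (b ^ 3 + b ^ 2 - 1) * h2
  · rintro b' ⟨hb', hcb'⟩
    have hd : Tr (b' + b) = 0 := by
      simp only [Tr, map_add] at hb hb' ⊢
      rw [hb, hb', add_zero]
    refine CharTwo.add_eq_zero.1 (hinj _ hd (hinj _ (Tr_artinSchreier _) ?_))
    rw [hby.symm] at hyc
    have e : (b + b') ^ 2 = b ^ 2 + b' ^ 2 := CharTwo.add_sq _ _
    have e4 : (b + b') ^ 4 = b ^ 4 + b' ^ 4 := by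
      rw [show (b + b') ^ 4 = ((b + b') ^ 2) ^ 2 by ring, e, CharTwo.add_sq]; ring
    linear_combination e4 + hyc - hcb' + 
      ((b' + b) ^ 3 + (b' + b) ^ 2 - b ^ 3 - b ^ 2 + c) * h2

end

/-! ### Elementary symmetric sums along a periodic sequence -/

section
variable {R : Type*} [CommRing R]

/-- The second elementary symmetric sum `∑_{i < j < n} b i * b j`. -/
def pairSum (n : ℕ) (b : ℕ → R) : R :=
  ∑ j ∈ Finset.range n, ∑ i ∈ Finset.range j, b i * b j

theorem sum_sq_eq (n : ℕ) (b : ℕ → R) :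
    (∑ i ∈ Finset.range n, b i) ^ 2 = ∑ i ∈ Finset.range n, b i ^ 2 + 2 * pairSum n b := by
  induction n with
  | zero => simp [pairSum]
  | succ n ih =>
    rw [pairSum, Finset.sum_range_succ, Finset.sum_range_succ, Finset.sum_range_succ, ← pairSum,
      add_sq, ih, ← Finset.sum_mul]
    ring

theorem sum_shift {n : ℕ} {b : ℕ → R} (hb : b n = b 0) :
    ∑ i ∈ Finset.range n, b (i + 1) = ∑ i ∈ Finset.range n, b i := by
  have h := Finset.sum_range_succ b n
  rw [Finset.sum_range_succ' b n, hb] at h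
  exact add_right_cancel h

/-- The elementary symmetric sum of a periodic sequence is invariant under the shift; the induction
keeps track of the boundary terms. -/
theorem pairSum_shift {n : ℕ} {b : ℕ → R} (hb : b n = b 0) :
    pairSum n (fun i => b (i + 1)) = pairSum n b := by
  have h : ∀ m : ℕ, pairSum m (fun i => b (i + 1)) + b 0 * ∑ j ∈ Finset.range m, b (j + 1) =
      pairSum m b + b m * ∑ i ∈ Finset.range m, b i := by
    intro m
    induction m with
    | zero => simp [pairSum]
    | succ m ih =>
      have e1 := Finset.sum_range_succ' b m
      rw [pairSum, pairSum, Finset.sum_range_succ, Finset.sum_range_succ, Finset.sum_range_succ,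
        ← pairSum, ← pairSum, ← Finset.sum_mul, ← Finset.sum_mul, e1]
      linear_combination ih
  have hn := h n
  rw [hb, sum_shift hb] at hn
  exact add_right_cancel hn

end

section
variable {F : Type*} [Field F]

theorem Q_eq_pairSum (n : ℕ) (a : F) : Q n a = pairSum n fun i => a ^ 2 ^ i := by
  simp only [Q, pairSum, pow_add]

end

section
variable {F : Type*} [Field F] [Algebra (ZMod 2) F] [Fintype F]

/-- Squaring shifts the sequence of conjugates of `a`, so that `Q n a` is its own square. -/
theorem Q_eq_zero_or_one {n : ℕ} (hF : Fintype.card F = 2 ^ n) (a : F) :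
    Q n a = 0 ∨ Q n a = 1 := by
  have := charP_two (F := F)
  have hb : a ^ 2 ^ n = a ^ 2 ^ 0 := by rw [← hF, FiniteField.pow_card, pow_zero, pow_one]
  have h : Q n a ^ 2 = Q n a := by
    conv_rhs => rw [Q_eq_pairSum, ← pairSum_shift (b := fun i => a ^ 2 ^ i) hb]
    rw [Q_eq_pairSum, pairSum, pairSum, CharTwo.sum_sq]
    refine Finset.sum_congr rfl fun j _ => ?_
    rw [CharTwo.sum_sq]
    refine Finset.sum_congr rfl fun i _ => ?_
    rw [mul_pow, ← pow_mul, ← pow_mul, pow_succ, pow_succ]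
  refine (sq_eq_self_iff _).1 ?_
  rw [h, CharTwo.add_self_eq_zero]

end

/-! ### Teichmüller expansion of the trace modulo four -/

section
variable {F : Type*} [Field F]

/-- The Teichmüller representative in the Witt vectors of `F`. -/
noncomputable def teich (x : F) : WittVector 2 F := WittVector.teichmuller 2 x

theorem constantCoeff_teich (x : F) : WittVector.constantCoeff (teich x) = x :=
  WittVector.teichmuller_coeff_zero 2 x

/-- The lift `∑_{i < n} [x] ^ (2 ^ i)` of the trace to the Witt vectors. -/
noncomputable def liftTr (n : ℕ) (x : F) : WittVector 2 F :=
  ∑ i ∈ Finset.range n, teich x ^ 2 ^ i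

/-- The lift of `Q n x` to the Witt vectors. -/
noncomputable def liftQ (n : ℕ) (x : F) : WittVector 2 F := pairSum n fun i => teich x ^ 2 ^ i

theorem constantCoeff_liftQ (n : ℕ) (x : F) :
    WittVector.constantCoeff (liftQ n x) = Q n x := by
  simp only [liftQ, Q_eq_pairSum, pairSum, map_sum, map_mul, map_pow, constantCoeff_teich]

/-- Squaring permutes the conjugates `[x] ^ (2 ^ i)`, leaving only the mixed terms. -/
theorem liftTr_sq [Fintype F] {n : ℕ} (hF : Fintype.card F = 2 ^ n) (x : F) :
    liftTr n x ^ 2 = liftTr n x + 2 * liftQ n x := by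
  have hb : teich x ^ 2 ^ n = teich x ^ 2 ^ 0 := by
    rw [teich, ← map_pow, ← hF, FiniteField.pow_card, pow_zero, pow_one]
  rw [liftTr, liftQ, sum_sq_eq, ← sum_shift (b := fun i => teich x ^ 2 ^ i) hb]
  simp only [← pow_mul, ← pow_succ]

end

section
variable {F : Type*} [Field F] [Algebra (ZMod 2) F]

theorem two_ne_zero_witt : (2 : WittVector 2 F) ≠ 0 := by
  have := charP_two (F := F)
  exact_mod_cast WittVector.p_nonzero 2 F

theorem two_dvd_of_witt {m : ℤ} (h : (2 : WittVector 2 F) ∣ m) : (2 : ℤ) ∣ m := by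
  have := charP_two (F := F)
  obtain ⟨w, hw⟩ := h
  have h0 := congrArg WittVector.constantCoeff hw
  rw [map_mul, map_intCast, map_ofNat, CharTwo.two_eq_zero, zero_mul] at h0
  exact_mod_cast (CharP.intCast_eq_zero_iff F 2 m).1 h0

theorem four_dvd_of_witt {m : ℤ} (h : (4 : WittVector 2 F) ∣ m) : (4 : ℤ) ∣ m := by
  have := charP_two (F := F)
  have h22 : (4 : WittVector 2 F) = 2 * 2 := by norm_num
  obtain ⟨l, rfl⟩ := two_dvd_of_witt (F := F) ((Dvd.intro _ h22.symm).trans h)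
  rw [h22, Int.cast_mul, Int.cast_ofNat, mul_dvd_mul_iff_left two_ne_zero_witt] at h
  obtain ⟨k, rfl⟩ := two_dvd_of_witt h
  exact ⟨k, by ring⟩

/-- The value of the trace in `{0, 1}`, as an integer. -/
noncomputable def trInt (x : F) : ℤ := (Tr x).val

theorem trInt_sq (x : F) : trInt x ^ 2 = trInt x := by
  unfold trInt
  generalize Tr x = u
  decide +revert

theorem trInt_of_Tr_eq_zero {x : F} (h : Tr x = 0) : trInt x = 0 := by
  rw [trInt, h]; rfl

theorem trInt_of_Tr_eq_one {x : F} (h : Tr x = 1) : trInt x = 1 := by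
  rw [trInt, h]; rfl

variable [Fintype F]

theorem two_dvd_of_coeff_zero {w : WittVector 2 F} (h : WittVector.constantCoeff w = 0) :
    (2 : WittVector 2 F) ∣ w := by
  have := charP_two (F := F)
  have h' := (WittVector.mem_span_p_iff_coeff_zero_eq_zero (p := 2) w).2 h
  exact_mod_cast Ideal.mem_span_singleton.1 h'

theorem constantCoeff_liftTr {n : ℕ} (hF : Fintype.card F = 2 ^ n) (x : F) :
    WittVector.constantCoeff (liftTr n x) = algebraMap (ZMod 2) F (Tr x) := by
  rw [FiniteField.algebraMap_trace_eq_sum_pow, finrank_eq hF, liftTr, map_sum]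
  simp only [map_pow, constantCoeff_teich, Nat.card_zmod]

/-- The lift of the trace agrees with the trace modulo two, so that its square agrees with it
modulo four. -/
theorem trInt_eq {n : ℕ} (hF : Fintype.card F = 2 ^ n) (x : F) :
    ∃ w : WittVector 2 F, (trInt x : WittVector 2 F) = liftTr n x + 2 * liftQ n x + 4 * w := by
  have h : (2 : WittVector 2 F) ∣ trInt x - liftTr n x := by
    apply two_dvd_of_coeff_zero
    rw [map_sub, constantCoeff_liftTr hF, map_intCast, sub_eq_zero, trInt, Int.cast_natCast,
      ← map_natCast (algebraMap (ZMod 2) F), ZMod.natCast_zmod_val]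
  obtain ⟨v, hv⟩ := h
  refine ⟨liftTr n x * v + v ^ 2, ?_⟩
  rw [← liftTr_sq hF, ← trInt_sq, Int.cast_pow, sub_eq_iff_eq_add.1 hv]
  ring

/-! ### Orthogonality of the Teichmüller characters -/

/-- The sum over the units is that of the character `[x] ^ (l - k)`, which is trivial only when
`k = l`, since `0 < k, l < 2 ^ n - 1`. -/
theorem sum_teich {n : ℕ} (hF : Fintype.card F = 2 ^ n) (a : F) {k l : ℕ}
    (hk : 0 < k) (hk' : k < 2 ^ n - 1) (hl' : l < 2 ^ n - 1) :
    ∑ x : F, teich x⁻¹ ^ k * teich (a * x) ^ l =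
      if k = l then (2 ^ n - 1) * teich a ^ k else 0 := by
  classical
  have := charP_two (F := F)
  let f : Fˣ →* WittVector 2 F :=
    { toFun := fun u => teich (u : F)⁻¹ ^ k * teich (u : F) ^ l
      map_one' := by simp [teich]
      map_mul' := fun u v => by simp [teich, mul_pow]; ring }
  have h1 : ∑ x : F, teich x⁻¹ ^ k * teich (a * x) ^ l = teich a ^ l * ∑ u : Fˣ, f u := by
    -- the term at `x = 0` vanishes because `0 < k`
    rw [← Finset.add_sum_erase _ _ (Finset.mem_univ (0 : F))]
    rw [inv_zero, teich, WittVector.teichmuller_zero, zero_pow hk.ne', zero_mul, zero_add,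
      Finset.mul_sum]
    symm
    refine Finset.sum_bij (fun u _ => (u : F)) (fun u _ => by simp) (fun u _ v _ h => Units.ext h)
      (fun x hx => ⟨Units.mk0 x (Finset.ne_of_mem_erase hx), Finset.mem_univ _, rfl⟩) ?_
    intro u _
    simp only [f, teich, MonoidHom.coe_mk, OneHom.coe_mk, map_mul, mul_pow]
    ring
  rw [h1, sum_hom_units]
  have hcard : Fintype.card Fˣ = 2 ^ n - 1 := by rw [Fintype.card_units, hF]
  split_ifs with hf hkl hkl
  · rw [hcard, Nat.cast_sub Nat.one_le_two_pow, hkl]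
    push_cast
    ring
  · exfalso
    obtain ⟨g, hg⟩ := IsCyclic.exists_ofOrder_eq_natCard (α := Fˣ)
    rw [Nat.card_eq_fintype_card, hcard] at hg
    have h := congrArg WittVector.constantCoeff (DFunLike.congr_fun hf g)
    simp only [f, MonoidHom.coe_mk, OneHom.coe_mk, map_mul, map_pow, constantCoeff_teich,
      MonoidHom.one_apply, map_one] at h
    have h' : g ^ k = g ^ l := by
      ext
      rw [Units.val_pow_eq_pow_val, Units.val_pow_eq_pow_val]
      have hg0 : (g : F) ^ k ≠ 0 := pow_ne_zero _ g.ne_zero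
      rw [inv_pow] at h
      field_simp at h
      exact h.symm
    rw [pow_inj_mod, hg, Nat.mod_eq_of_lt hk', Nat.mod_eq_of_lt hl'] at h'
    exact hkl h'
  · exfalso
    apply hf
    ext1 u
    simp only [f, MonoidHom.coe_mk, OneHom.coe_mk, MonoidHom.one_apply, hkl, teich]
    rw [← mul_pow, ← map_mul, inv_mul_cancel₀ u.ne_zero, map_one, one_pow]
  · simp

theorem two_pow_lt {n i : ℕ} (hn : 3 ≤ n) (hi : i < n) : 2 ^ i < 2 ^ n - 1 := by
  have h1 : 2 ^ i ≤ 2 ^ (n - 1) := Nat.pow_le_pow_right (by norm_num) (by omega)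
  have h2 : 2 ^ 2 ≤ 2 ^ (n - 1) := Nat.pow_le_pow_right (by norm_num) (by omega)
  have h3 : 2 ^ n = 2 * 2 ^ (n - 1) := by rw [← pow_succ']; congr 1; omega
  omega

theorem two_pow_add_lt {n i j : ℕ} (hn : 3 ≤ n) (hij : i < j) (hj : j < n) :
    2 ^ i + 2 ^ j < 2 ^ n - 1 := by
  have h1 : 2 ^ j ≤ 2 ^ (n - 1) := Nat.pow_le_pow_right (by norm_num) (by omega)
  have h2 : 2 ^ i ≤ 2 ^ (n - 2) := Nat.pow_le_pow_right (by norm_num) (by omega)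
  have h0 : 2 ^ 1 ≤ 2 ^ (n - 2) := Nat.pow_le_pow_right (by norm_num) (by omega)
  have h3 : 2 ^ n = 2 * 2 ^ (n - 1) := by rw [← pow_succ']; congr 1; omega
  have h4 : 2 ^ (n - 1) = 2 * 2 ^ (n - 2) := by rw [← pow_succ']; congr 1; omega
  omega

theorem two_pow_ne_add {i j k : ℕ} (hij : i < j) : 2 ^ k ≠ 2 ^ i + 2 ^ j := by
  intro h
  have h1 : 2 ^ i < 2 ^ j := Nat.pow_lt_pow_right (by norm_num) hij
  have h0 : 0 < 2 ^ i := by positivity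
  have h2 : j < k := (Nat.pow_lt_pow_iff_right (a := 2) (by norm_num)).1 (by omega)
  have h3 : 2 ^ (j + 1) ≤ 2 ^ k := Nat.pow_le_pow_right (by norm_num) h2
  rw [pow_succ] at h3
  omega

theorem sum_liftTr_mul_liftTr {n : ℕ} (hn : 3 ≤ n) (hF : Fintype.card F = 2 ^ n) (a : F) :
    ∑ x : F, liftTr n x⁻¹ * liftTr n (a * x) = (2 ^ n - 1) * liftTr n a := by
  simp_rw [liftTr, Finset.sum_mul_sum]
  rw [Finset.mul_sum]
  rw [Finset.sum_comm]
  refine Finset.sum_congr rfl fun i hi => ?_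
  rw [Finset.sum_comm, Finset.sum_eq_single_of_mem i hi]
  · rw [sum_teich hF a (by positivity) (two_pow_lt hn (Finset.mem_range.1 hi))
      (two_pow_lt hn (Finset.mem_range.1 hi)), if_pos rfl]
  · intro j hj hji
    rw [sum_teich hF a (by positivity) (two_pow_lt hn (Finset.mem_range.1 hi))
      (two_pow_lt hn (Finset.mem_range.1 hj)),
      if_neg fun h => hji (Nat.pow_right_injective le_rfl h).symm]

/-- A power of two is never a sum of two distinct powers of two, so all terms are orthogonal. -/
theorem sum_liftTr_mul_liftQ {n : ℕ} (hn : 3 ≤ n) (hF : Fintype.card F = 2 ^ n) (a : F) :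
    ∑ x : F, liftTr n x⁻¹ * liftQ n (a * x) = 0 := by
  simp only [liftTr, liftQ, pairSum, Finset.sum_mul, Finset.mul_sum, ← pow_add]
  rw [Finset.sum_comm]
  refine Finset.sum_eq_zero fun j hj => ?_
  rw [Finset.sum_comm]
  refine Finset.sum_eq_zero fun i hi => ?_
  rw [Finset.sum_comm]
  refine Finset.sum_eq_zero fun k hk => ?_
  rw [Finset.mem_range] at hi hj hk
  rw [sum_teich hF a (by positivity) (two_pow_lt hn hk)
    (two_pow_add_lt hn hi hj), if_neg (two_pow_ne_add hi)]

theorem sum_liftQ_mul_liftTr {n : ℕ} (hn : 3 ≤ n) (hF : Fintype.card F = 2 ^ n) (a : F) :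
    ∑ x : F, liftQ n x⁻¹ * liftTr n (a * x) = 0 := by
  simp only [liftTr, liftQ, pairSum, Finset.sum_mul, Finset.mul_sum, ← pow_add]
  rw [Finset.sum_comm]
  refine Finset.sum_eq_zero fun k hk => ?_
  rw [Finset.sum_comm]
  refine Finset.sum_eq_zero fun j hj => ?_
  rw [Finset.sum_comm]
  refine Finset.sum_eq_zero fun i hi => ?_
  rw [Finset.mem_range] at hi hj hk
  rw [sum_teich hF a (by positivity) (two_pow_add_lt hn hi hj)
    (two_pow_lt hn hk), if_neg (two_pow_ne_add hi).symm]

/-! ### The Kloosterman sum modulo sixteen -/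

/-- The number of `x` with `Tr x⁻¹ = Tr (a x) = 1`, modulo four. After expansion of both factors
modulo four, only the product of the two lifted traces survives summation over `x`, and it gives
`(2 ^ n - 1) * liftTr n a`. -/
theorem sum_trInt_mul_trInt {n : ℕ} (hn : 3 ≤ n) (hF : Fintype.card F = 2 ^ n) (a : F) {e : ℤ}
    (he : (e : F) = Q n a) :
    ∑ x : F, trInt x⁻¹ * trInt (a * x) ≡ -trInt a - 2 * e [ZMOD 4] := by
  choose w hw using trInt_eq hF
  have hsum : ∃ v : WittVector 2 F,
      ((∑ x : F, trInt x⁻¹ * trInt (a * x) : ℤ) : WittVector 2 F) = -liftTr n a + 4 * v := by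
    have hn4 : (2 : WittVector 2 F) ^ n = 4 * 2 ^ (n - 2) := by
      rw [show (4 : WittVector 2 F) = 2 ^ 2 by norm_num, ← pow_add]
      congr 1
      omega
    refine ⟨2 ^ (n - 2) * liftTr n a + ∑ x : F, (liftQ n x⁻¹ * liftQ n (a * x) +
      w x⁻¹ * (liftTr n (a * x) + 2 * liftQ n (a * x) + 4 * w (a * x)) +
      (liftTr n x⁻¹ + 2 * liftQ n x⁻¹) * w (a * x)), ?_⟩
    have e0 : ((∑ x : F, trInt x⁻¹ * trInt (a * x) : ℤ) : WittVector 2 F) =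
        ∑ x : F, (liftTr n x⁻¹ * liftTr n (a * x) + 2 * (liftTr n x⁻¹ * liftQ n (a * x)) +
        2 * (liftQ n x⁻¹ * liftTr n (a * x)) + 4 * (liftQ n x⁻¹ * liftQ n (a * x) +
        w x⁻¹ * (liftTr n (a * x) + 2 * liftQ n (a * x) + 4 * w (a * x)) +
        (liftTr n x⁻¹ + 2 * liftQ n x⁻¹) * w (a * x))) := by
      rw [Int.cast_sum]
      refine Finset.sum_congr rfl fun x _ => ?_
      rw [Int.cast_mul, hw, hw]
      ring
    rw [e0]
    simp only [Finset.sum_add_distrib, ← Finset.mul_sum]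
    rw [sum_liftTr_mul_liftTr hn hF, sum_liftTr_mul_liftQ hn hF, sum_liftQ_mul_liftTr hn hF, hn4]
    ring
  obtain ⟨v, hv⟩ := hsum
  have hQ : (2 : WittVector 2 F) ∣ liftQ n a - e := by
    apply two_dvd_of_coeff_zero
    rw [map_sub, constantCoeff_liftQ, map_intCast, he, sub_self]
  obtain ⟨r, hr⟩ := hQ
  refine (Int.modEq_iff_dvd.2 (four_dvd_of_witt (F := F) ⟨v + w a + r + e, ?_⟩)).symm
  rw [Int.cast_sub, hv]
  push_cast
  rw [hw a]
  linear_combination 2 * hr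

/-- With `u, v ∈ {0, 1}` the two traces, the terms of `K n a` are
`(1 - 2 u) (1 - 2 v) = (1 - 2 u) + (1 - 2 v) - 1 + 4 u v`, where the first two summands are values of
`chi` that sum to zero over the field. -/
theorem K_modEq_sixteen {n : ℕ} (hn : 4 ≤ n) (hF : Fintype.card F = 2 ^ n) {a : F} (ha : a ≠ 0)
    {e : ℤ} (he : (e : F) = Q n a) : K n a ≡ -4 * trInt a - 8 * e [ZMOD 16] := by
  have hN := sum_trInt_mul_trInt (by omega) hF a he
  have hK : K n a = -2 ^ n + 4 * ∑ x : F, trInt x⁻¹ * trInt (a * x) := by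
    have e0 : ∀ x : F, chi x⁻¹ * chi (a * x) =
        chi x⁻¹ + chi (a * x) - 1 + 4 * (trInt x⁻¹ * trInt (a * x)) := fun x => by
      rw [chi_eq, chi_eq, trInt, trInt]
      ring
    rw [K_eq_sum_inv (by omega) hF]
    simp only [e0, Finset.sum_add_distrib, Finset.sum_sub_distrib, ← Finset.mul_sum]
    rw [sum_chi_inv, sum_chi_mul ha, Finset.sum_const, Finset.card_univ, hF]
    simp
  have h16 : (2 : ℤ) ^ n = 16 * 2 ^ (n - 4) := by
    rw [show (16 : ℤ) = 2 ^ 4 by norm_num, ← pow_add]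
    congr 1
    omega
  rw [h16] at hK
  generalize (2 : ℤ) ^ (n - 4) = q at hK
  unfold Int.ModEq at hN ⊢
  omega

end

/-! ### Reduction modulo three to a cubic sum -/

section
variable {F : Type*} [Field F] [Algebra (ZMod 2) F] [Fintype F]

/-- The cubic exponential sum `∑_x (-1) ^ Tr(x ^ 3 + c x)`. -/
noncomputable def cubicSum (c : F) : ℤ := ∑ x : F, chi (x ^ 3 + c * x)

/-- The cubic sum in which the Dickson polynomial `t ^ 3 + t` appears. -/
theorem sum_chi_dickson {c : F} (hc : c ≠ 0) :
    ∑ t : F, chi (c ^ 3 * (t ^ 3 + t)) = cubicSum c := by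
  have h1 : ∑ t : F, chi (c ^ 3 * (t ^ 3 + t)) = ∑ t : F, chi (t ^ 3 + c ^ 2 * t) := by
    rw [← Equiv.sum_comp (Equiv.mulLeft₀ c hc) fun t => chi (t ^ 3 + c ^ 2 * t)]
    refine Finset.sum_congr rfl fun t _ => congrArg chi ?_
    simp only [Equiv.mulLeft₀_apply]
    ring
  have h2 : ∑ t : F, chi (t ^ 3 + c ^ 2 * t) = ∑ s : F, chi (s ^ 3 + c * s) := by
    rw [← Equiv.sum_comp (FiniteField.frobeniusAlgEquivOfAlgebraic (ZMod 2) F).toEquiv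
      fun t => chi (t ^ 3 + c ^ 2 * t)]
    refine Finset.sum_congr rfl fun s _ => ?_
    have := charP_two (F := F)
    rw [← chi_sq (s ^ 3 + c * s), CharTwo.add_sq]
    congr 1
    simp
    ring
  rw [h1, h2, cubicSum]

open Classical in
/-- The elements `x + x⁻¹` with `x ≠ 0, 1` in the field: the nonzero `t` with `Tr t⁻¹ = 0`. -/
noncomputable def splitSet (F : Type*) [Field F] [Algebra (ZMod 2) F] [Fintype F] : Finset F :=
  Finset.univ.filter fun t => t ≠ 0 ∧ Tr t⁻¹ = 0

open Classical in
/-- The elements `u + u⁻¹` with `u ≠ 1` of norm one in the quadratic extension: the `t` with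
`Tr t⁻¹ = 1`. The convention `0⁻¹ = 0` excludes `t = 0`. -/
noncomputable def inertSet (F : Type*) [Field F] [Algebra (ZMod 2) F] [Fintype F] : Finset F :=
  Finset.univ.filter fun t => Tr t⁻¹ = 1

theorem mem_splitSet {t : F} : t ∈ splitSet F ↔ t ≠ 0 ∧ Tr t⁻¹ = 0 := by
  simp [splitSet]

theorem mem_inertSet {t : F} : t ∈ inertSet F ↔ Tr t⁻¹ = 1 := by
  simp [inertSet]

theorem ne_zero_of_mem_inertSet {t : F} (ht : t ∈ inertSet F) : t ≠ 0 := by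
  rintro rfl
  simp [mem_inertSet] at ht

theorem sum_univ_eq (f : F → ℤ) :
    ∑ t : F, f t = f 0 + ∑ t ∈ splitSet F, f t + ∑ t ∈ inertSet F, f t := by
  classical
  have hd : Disjoint (splitSet F) (inertSet F) := by
    rw [Finset.disjoint_left]
    intro t h0 h1
    rw [mem_splitSet] at h0
    rw [mem_inertSet, h0.2] at h1
    exact zero_ne_one h1
  have hz : (0 : F) ∉ splitSet F ∪ inertSet F := by
    simp [mem_splitSet, mem_inertSet]
  have hu : insert 0 (splitSet F ∪ inertSet F) = Finset.univ := by
    ext t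
    simp only [Finset.mem_insert, Finset.mem_union, mem_splitSet, mem_inertSet, Finset.mem_univ,
      iff_true]
    have := Tr_eq_zero_or_one t⁻¹
    tauto
  rw [← hu, Finset.sum_insert hz, Finset.sum_union hd, add_assoc]

/-- In `K n a` the terms of `inertSet F` enter with the sign `-1`; by the vanishing of
`∑ t, chi (a * t)` they contribute as much as those of `splitSet F`. -/
theorem K_eq_sum_splitSet {n : ℕ} (hn : 2 ≤ n) (hF : Fintype.card F = 2 ^ n) {a : F}
    (ha : a ≠ 0) : K n a = 2 + 2 * ∑ t ∈ splitSet F, chi (a * t) := by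
  have hK := K_eq_sum_inv hn hF a
  have h0 := sum_chi_mul ha
  rw [sum_univ_eq] at hK h0
  have e0 : ∑ t ∈ splitSet F, chi t⁻¹ * chi (a * t) = ∑ t ∈ splitSet F, chi (a * t) :=
    Finset.sum_congr rfl fun t ht => by
      rw [chi_of_Tr_eq_zero (mem_splitSet.1 ht).2, one_mul]
  have e1 : ∑ t ∈ inertSet F, chi t⁻¹ * chi (a * t) = -∑ t ∈ inertSet F, chi (a * t) := by
    rw [← Finset.sum_neg_distrib]
    exact Finset.sum_congr rfl fun t ht => by
      rw [chi_of_Tr_eq_one (mem_inertSet.1 ht), neg_one_mul]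
  rw [e0, e1] at hK
  simp only [inv_zero, mul_zero, chi_zero] at hK h0
  omega

theorem Tr_inv_dickson {t : F} (h0 : t ≠ 0) (h1 : t ≠ 1) : Tr (t ^ 3 + t)⁻¹ = Tr t⁻¹ := by
  have := charP_two (F := F)
  have h2 : (2 : F) = 0 := CharTwo.two_eq_zero
  have h1' : t + 1 ≠ 0 := fun h => h1 (CharTwo.add_eq_zero.1 h)
  have hne : t ^ 3 + t ≠ 0 := by
    rw [show t ^ 3 + t = t * (t + 1) ^ 2 by linear_combination (-t ^ 2) * h2]
    exact mul_ne_zero h0 (pow_ne_zero 2 h1')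
  -- the partial fraction decomposition of `1 / (t (t + 1) ^ 2)`
  have h : (t ^ 3 + t)⁻¹ = t⁻¹ + (((t + 1)⁻¹) ^ 2 + (t + 1)⁻¹) := by
    refine inv_eq_of_mul_eq_one_right ?_
    field_simp
    linear_combination (t ^ 4 + 2 * t ^ 3 + t ^ 2 + t) * h2
  rw [h, Tr, map_add]
  exact (congrArg _ (Tr_artinSchreier _)).trans (add_zero _)

/-- Two distinct elements with the same image under `t ↦ t ^ 3 + t` differ by `t z`, where
`z ^ 2 + z = 1 + t ^ (-2)`. As `Tr 1 = 1`, this is solvable only when `Tr t⁻¹ = 1`. -/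
theorem Tr_inv_of_dickson_eq {n : ℕ} (hn : Odd n) (hF : Fintype.card F = 2 ^ n) {s t : F}
    (ht : t ≠ 0) (hst : s ≠ t) (h : s ^ 3 + s = t ^ 3 + t) : Tr t⁻¹ = 1 := by
  have := charP_two (F := F)
  have h2 : (2 : F) = 0 := CharTwo.two_eq_zero
  have hq : s ^ 2 + s * t + t ^ 2 + 1 = 0 := by
    have hne : s - t ≠ 0 := sub_ne_zero.2 hst
    refine (mul_eq_zero.1 (?_ : (s - t) * _ = 0)).resolve_left hne
    linear_combination h
  have hz : ((s + t) * t⁻¹) ^ 2 + (s + t) * t⁻¹ = t⁻¹ ^ 2 + 1 := by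
    field_simp
    linear_combination hq + (s * t - 1) * h2
  have hT := Tr_artinSchreier ((s + t) * t⁻¹)
  have h1 := Tr_one hn hF
  have hs := Tr_sq t⁻¹
  rw [hz] at hT
  simp only [Tr, map_add] at hT h1 hs ⊢
  rw [h1, hs] at hT
  exact CharTwo.add_eq_zero.1 hT

/-- With `t = x + x⁻¹`, the map `t ↦ t ^ 3 + t` is `x ↦ x ^ 3`. It permutes `splitSet F`, as `3` is
prime to `2 ^ n - 1`. -/
theorem sum_splitSet_dickson {n : ℕ} (hn : Odd n) (hF : Fintype.card F = 2 ^ n) (f : F → ℤ) :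
    ∑ t ∈ splitSet F, f (t ^ 3 + t) = ∑ t ∈ splitSet F, f t := by
  have hmaps : ∀ t ∈ splitSet F, t ^ 3 + t ∈ splitSet F := by
    intro t ht
    rw [mem_splitSet] at ht ⊢
    have h1 : t ≠ 1 := by
      rintro rfl
      rw [inv_one, Tr_one hn hF] at ht
      exact one_ne_zero ht.2
    have hT := Tr_inv_dickson ht.1 h1
    refine ⟨fun h => ?_, hT.trans ht.2⟩
    have := charP_two (F := F)
    have : t * (t ^ 2 + 1 ^ 2) = 0 := by linear_combination h
    rw [← CharTwo.add_sq, mul_eq_zero, or_iff_right ht.1, pow_eq_zero_iff two_ne_zero,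
      CharTwo.add_eq_zero] at this
    exact h1 this
  have hinj : Set.InjOn (fun t : F => t ^ 3 + t) (splitSet F) := by
    intro s hs t ht h
    by_contra hst
    have ht' := mem_splitSet.1 ht
    rw [Tr_inv_of_dickson_eq hn hF ht'.1 hst h] at ht'
    exact one_ne_zero ht'.2
  exact Finset.sum_nbij (fun t => t ^ 3 + t) hmaps hinj
    (Finset.surjOn_of_injOn_of_card_le _ hmaps hinj le_rfl) fun _ _ => rfl

/-- On `inertSet F` the map `t ↦ t ^ 3 + t` is induced by cubing on the cyclic group of norm one
elements, of order `2 ^ n + 1`, which is divisible by three. Its fibres other than that of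
`t = 1` therefore have three elements. -/
theorem card_fiber_dickson {n : ℕ} (hn : Odd n) (hF : Fintype.card F = 2 ^ n) [DecidableEq F]
    {t : F} (ht : t ∈ inertSet F) (ht1 : t ≠ 1) :
    (((inertSet F).erase 1).filter fun s => s ^ 3 + s = t ^ 3 + t).card = 3 := by
  have := charP_two (F := F)
  have h2 : (2 : F) = 0 := CharTwo.two_eq_zero
  have ht0 := ne_zero_of_mem_inertSet ht
  have h1 := Tr_one hn hF
  have hT : Tr (t⁻¹ ^ 2 + 1) = 0 := by
    have hs := Tr_sq t⁻¹
    rw [mem_inertSet] at ht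
    simp only [Tr, map_add] at hs h1 ht ⊢
    rw [hs, h1, ht]; rfl
  obtain ⟨z, hz⟩ := exists_sq_add_self hT
  have hz' : (z * t) ^ 2 + z * t * t = 1 + t ^ 2 := by
    have : (z * t) ^ 2 + z * t * t = (z ^ 2 + z) * t ^ 2 := by ring
    rw [this, hz]
    field_simp
  have hne : (1 + t) ^ 2 ≠ 0 := fun h =>
    ht1 (CharTwo.add_eq_zero.1 ((pow_eq_zero_iff two_ne_zero).1 h)).symm
  rw [CharTwo.add_sq, one_pow] at hne
  have hzt : z * t ≠ 0 := fun h => hne (by rw [← hz', h]; ring)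
  have hz1 : z * t + t ≠ 0 := fun h => hne (by
    rw [← hz']; linear_combination z * t * h)
  -- the three solutions are `t`, `t + z t` and `z t`
  rw [Finset.card_eq_three]
  refine ⟨t, t + z * t, z * t, ?_, ?_, ?_, ?_⟩
  · simpa using hzt
  · intro h
    exact hz1 (by rw [← h]; linear_combination t * h2)
  · simpa using ht0
  ext s
  simp only [Finset.mem_filter, Finset.mem_erase, Finset.mem_insert, Finset.mem_singleton]
  have hfac : (s ^ 3 + s) - (t ^ 3 + t) = (s - t) * ((s - (t + z * t)) * (s - z * t)) := by
    linear_combination (s - t) * (-hz' + (s * t + s * z * t) * h2)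
  constructor
  · rintro ⟨-, h⟩
    rw [h, sub_self, eq_comm, mul_eq_zero, mul_eq_zero, sub_eq_zero, sub_eq_zero, sub_eq_zero]
      at hfac
    exact hfac
  · intro hs
    have h : s ^ 3 + s = t ^ 3 + t := by
      rw [← sub_eq_zero, hfac, mul_eq_zero, mul_eq_zero, sub_eq_zero, sub_eq_zero, sub_eq_zero]
      exact hs
    refine ⟨?_, h⟩
    rcases eq_or_ne t s with rfl | hts
    · exact ⟨ht1, ht⟩
    have hs0 : s ≠ 0 := by
      rintro rfl
      apply hne
      have : t * (1 + t ^ 2) = 0 := by linear_combination -h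
      exact (mul_eq_zero.1 this).resolve_left ht0
    refine ⟨?_, mem_inertSet.2 (Tr_inv_of_dickson_eq hn hF hs0 hts h.symm)⟩
    rintro rfl
    apply hne
    have : t * (1 + t ^ 2) = 0 := by linear_combination -h + h2
    exact (mul_eq_zero.1 this).resolve_left ht0

/-- The fibre of `t = 1`, which lies over `0`, is the only one of size prime to three. -/
theorem sum_inertSet_dickson {n : ℕ} (hn : Odd n) (hF : Fintype.card F = 2 ^ n) (f : F → ℤ) :
    ∑ t ∈ inertSet F, f (t ^ 3 + t) ≡ f 0 [ZMOD 3] := by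
  classical
  have := charP_two (F := F)
  have h1 : (1 : F) ∈ inertSet F := by rw [mem_inertSet, inv_one, Tr_one hn hF]
  rw [← Finset.add_sum_erase _ _ h1, one_pow, CharTwo.add_self_eq_zero,
    Finset.sum_comp f fun t => t ^ 3 + t]
  refine (Int.modEq_iff_dvd.2 ?_).symm
  rw [add_sub_cancel_left]
  refine Finset.dvd_sum fun s hs => ?_
  obtain ⟨t, ht, rfl⟩ := Finset.mem_image.1 hs
  rw [card_fiber_dickson hn hF (Finset.mem_of_mem_erase ht) (Finset.ne_of_mem_erase ht)]
  exact ⟨f (t ^ 3 + t), by simp⟩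

/-- The full cubic sum splits into the part over `splitSet F`, which is the one appearing in
`K n (c ^ 3)`, and the part over `inertSet F`, which is `1` modulo three. -/
theorem K_modEq_three {n : ℕ} (hn : Odd n) (hn2 : 2 ≤ n) (hF : Fintype.card F = 2 ^ n) {c : F}
    (hc : c ≠ 0) : K n (c ^ 3) ≡ 1 - cubicSum c [ZMOD 3] := by
  have hK := K_eq_sum_splitSet hn2 hF (pow_ne_zero 3 hc)
  have hC := sum_univ_eq fun t : F => chi (c ^ 3 * (t ^ 3 + t))
  have h0 := sum_splitSet_dickson hn hF fun s => chi (c ^ 3 * s)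
  have h1 := sum_inertSet_dickson hn hF fun s => chi (c ^ 3 * s)
  rw [sum_chi_dickson hc, h0] at hC
  rw [mul_zero, chi_zero] at h1
  rw [show c ^ 3 * ((0 : F) ^ 3 + 0) = 0 by ring, chi_zero] at hC
  unfold Int.ModEq at h1 ⊢
  omega

end

/-! ### Evaluation of the cubic sum -/

section
variable {F : Type*} [Field F] [Algebra (ZMod 2) F] [Fintype F]

/-- The translation `x ↦ x + 1` changes the sign of every term. -/
theorem cubicSum_eq_zero {n : ℕ} (hn : Odd n) (hF : Fintype.card F = 2 ^ n) {c : F}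
    (hc : Tr c = 0) : cubicSum c = 0 := by
  have := charP_two (F := F)
  have h2 : (2 : F) = 0 := CharTwo.two_eq_zero
  have h : cubicSum c = ∑ x : F, chi ((x + 1) ^ 3 + c * (x + 1)) :=
    (Equiv.sum_comp (Equiv.addRight (1 : F)) fun x => chi (x ^ 3 + c * x)).symm
  have e : ∀ x : F, chi ((x + 1) ^ 3 + c * (x + 1)) = -chi (x ^ 3 + c * x) := fun x => by
    rw [show (x + 1) ^ 3 + c * (x + 1) = x ^ 3 + c * x + (x ^ 2 + x) + c + 1 by
      linear_combination (x ^ 2 + x) * h2]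
    rw [chi_add, chi_add, chi_add, chi_of_Tr_eq_zero (Tr_artinSchreier x), chi_of_Tr_eq_zero hc,
      chi_of_Tr_eq_one (Tr_one hn hF)]
    ring
  simp only [e, Finset.sum_neg_distrib] at h
  rw [← cubicSum] at h
  omega

/-- Completing the cube: `x` is replaced by `x + β ^ 2`, and the trace is invariant under
squaring. -/
theorem cubicSum_quartic {β : F} (hβ : Tr β = 0) :
    cubicSum (β ^ 4 + β + 1) = chi (β ^ 3) * cubicSum (1 : F) := by
  have := charP_two (F := F)
  have h2 : (2 : F) = 0 := CharTwo.two_eq_zero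
  rw [cubicSum, ← Equiv.sum_comp (Equiv.addRight (β ^ 2)), cubicSum, Finset.mul_sum]
  refine Finset.sum_congr rfl fun x _ => ?_
  rw [Equiv.coe_addRight, show (x + β ^ 2) ^ 3 + (β ^ 4 + β + 1) * (x + β ^ 2) =
    β ^ 3 + (x ^ 3 + 1 * x) + ((β * x) ^ 2 + β * x) + β ^ 2 by
      linear_combination (β ^ 2 * x ^ 2 + 2 * β ^ 4 * x + β ^ 6) * h2]
  rw [chi_add, chi_add, chi_add, chi_of_Tr_eq_zero (Tr_artinSchreier _), chi_sq,
    chi_of_Tr_eq_zero hβ]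
  ring

/-- The radical of the quadratic form `Tr (x ^ 3 + x)` is the prime field when `n` is odd. -/
theorem cubicSum_one_sq {n : ℕ} (hn : Odd n) (hF : Fintype.card F = 2 ^ n) :
    cubicSum (1 : F) ^ 2 = 2 ^ (n + 1) := by
  classical
  have := charP_two (F := F)
  have h2 : (2 : F) = 0 := CharTwo.two_eq_zero
  have key : ∀ z : F, ∑ x : F, chi (x ^ 3 + 1 * x) * chi ((z + x) ^ 3 + 1 * (z + x)) =
      if z = 0 ∨ z = 1 then 2 ^ n else 0 := by
    intro z
    have e : ∀ x : F, chi (x ^ 3 + 1 * x) * chi ((z + x) ^ 3 + 1 * (z + x)) =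
        chi (z ^ 3 + z) * chi ((z ^ 4 + z) * x ^ 2) := fun x => by
      rw [← chi_add, ← chi_add, show x ^ 3 + 1 * x + ((z + x) ^ 3 + 1 * (z + x)) =
        z ^ 3 + z + z * x ^ 2 + z ^ 2 * x by
          linear_combination (x ^ 3 + x + z * x ^ 2 + z ^ 2 * x) * h2]
      rw [chi_add, ← chi_sq (z ^ 2 * x), ← chi_add]
      congr 1
      ring
    simp only [e, ← Finset.mul_sum]
    rw [Equiv.sum_comp (FiniteField.frobeniusAlgEquivOfAlgebraic (ZMod 2) F).toEquiv.symm
      (fun x : F => chi ((z ^ 4 + z) * x ^ 2)) |>.symm]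
    have e' : ∀ x : F, ((FiniteField.frobeniusAlgEquivOfAlgebraic (ZMod 2) F).toEquiv.symm x) ^ 2
        = x := fun x => by
      have := (FiniteField.frobeniusAlgEquivOfAlgebraic (ZMod 2) F).toEquiv.apply_symm_apply x
      simpa using this
    simp only [e']
    split_ifs with hz
    · have hz4 : z ^ 4 + z = 0 := by
        rcases hz with rfl | rfl
        · ring
        · linear_combination h2
      have hz3 : z ^ 3 + z = 0 := by
        rcases hz with rfl | rfl
        · ring
        · linear_combination h2
      simp [hz4, hz3, chi_zero, hF]
    · have hz4 : z ^ 4 + z ≠ 0 := by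
        intro h
        have h' : (z ^ 2 + z) ^ 2 + (z ^ 2 + z) = 0 := by
          linear_combination h + (z ^ 3 + z ^ 2) * h2
        rcases (sq_eq_self_iff _).1 h' with h' | h'
        · exact hz ((sq_eq_self_iff z).1 h')
        · have := Tr_artinSchreier z
          rw [h', Tr_one hn hF] at this
          exact one_ne_zero this
      rw [sum_chi_mul hz4, mul_zero]
  have hz : (Finset.univ.filter fun z : F => z = 0 ∨ z = 1) = {0, 1} := by
    ext z; simp
  calc cubicSum (1 : F) ^ 2
      = ∑ x : F, ∑ y : F, chi (x ^ 3 + 1 * x) * chi (y ^ 3 + 1 * y) := by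
        rw [sq, cubicSum, Finset.sum_mul_sum]
    _ = ∑ x : F, ∑ z : F, chi (x ^ 3 + 1 * x) * chi ((z + x) ^ 3 + 1 * (z + x)) :=
        Finset.sum_congr rfl fun x _ => (Equiv.sum_comp (Equiv.addRight x) fun y =>
          chi (x ^ 3 + 1 * x) * chi (y ^ 3 + 1 * y)).symm
    _ = ∑ z : F, if z = 0 ∨ z = 1 then 2 ^ n else 0 := by
        rw [Finset.sum_comm]
        exact Finset.sum_congr rfl fun z _ => key z
    _ = 2 ^ (n + 1) := by
        rw [← Finset.sum_filter, hz, Finset.sum_pair zero_ne_one]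
        ring

open Classical in
theorem cubicSum_one_eq_card :
    cubicSum (1 : F) = 2 * Fintype.card {x : F // Tr (x ^ 3 + x) = 0} - Fintype.card F := by
  have e : ∀ x : F, chi (x ^ 3 + 1 * x) = 2 * (if Tr (x ^ 3 + x) = 0 then 1 else 0) - 1 := by
    intro x
    rw [one_mul]
    rcases Tr_eq_zero_or_one (x ^ 3 + x) with h | h
    · rw [chi_of_Tr_eq_zero h, if_pos h]; rfl
    · rw [chi_of_Tr_eq_one h, if_neg (by rw [h]; exact one_ne_zero)]; rfl
  simp only [cubicSum, e, Finset.sum_sub_distrib, ← Finset.mul_sum, Finset.sum_boole,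
    Fintype.card_subtype]
  simp

end

section
variable {L F : Type*} [Field L] [Field F] [Algebra (ZMod 2) L] [Algebra (ZMod 2) F]
  [Algebra L F] [IsScalarTower (ZMod 2) L F] [Fintype L] [Fintype F]

theorem Tr_algebraMap (hodd : Odd (Module.finrank L F)) (x : L) :
    Tr (algebraMap L F x) = Tr x := by
  rw [Tr, ← Algebra.trace_trace (S := L), Algebra.trace_algebraMap, nsmul_eq_mul]
  obtain ⟨m, hm⟩ := hodd
  have := charP_two (F := L)
  have h : ((2 * m + 1 : ℕ) : L) = 1 := by
    push_cast
    linear_combination (m : L) * CharTwo.two_eq_zero (R := L)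
  rw [hm, h, one_mul]

/-- The Frobenius automorphism of `F` over `L` has order `p` and fixed field `L`, and it preserves
the set of zeros of `Tr (x ^ 3 + x)`. -/
theorem cubicSum_one_modEq {p : ℕ} (hp : p.Prime) (hodd : Odd p)
    (hLF : Module.finrank L F = p) : cubicSum (1 : F) ≡ cubicSum (1 : L) [ZMOD p] := by
  classical
  have := Fact.mk hp
  let σ := FiniteField.frobeniusAlgEquivOfAlgebraic L F
  have hTr : ∀ x : F, Tr ((σ x) ^ 3 + σ x) = Tr (x ^ 3 + x) := fun x => by
    have h := Algebra.trace_eq_of_algEquiv (σ.restrictScalars (ZMod 2)) (x ^ 3 + x)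
    simpa using h
  let f : Function.End {x : F // Tr (x ^ 3 + x) = 0} := fun x => ⟨σ x, (hTr x).trans x.2⟩
  have hord : orderOf σ = p :=
    (FiniteField.orderOf_frobeniusAlgEquivOfAlgebraic L F).trans hLF
  have hfpow : ∀ (k : ℕ) (x : {x : F // Tr (x ^ 3 + x) = 0}),
      (((f ^ k) x : {x : F // Tr (x ^ 3 + x) = 0}) : F) = (σ ^ k) x := by
    intro k
    induction k with
    | zero => intro x; rfl
    | succ k ih => intro x; rw [pow_succ, pow_succ]; exact ih (f x)
  have hf : f ^ p ^ 1 = 1 := by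
    funext x
    apply Subtype.ext
    rw [hfpow, pow_one, ← hord, pow_orderOf_eq_one]
    rfl
  have hcard := Equiv.Perm.card_fixedPoints_modEq hf
  have hfix : ∀ x : F, σ x = x → ∃ y : L, algebraMap L F y = x := by
    intro x hx
    rw [← Set.mem_range, IsGalois.mem_range_algebraMap_iff_fixed]
    intro g
    obtain ⟨k, rfl⟩ := (FiniteField.bijective_frobeniusAlgEquivOfAlgebraic_pow L F).2 g
    change (σ ^ (k : ℕ)) x = x
    generalize (k : ℕ) = m
    induction m with
    | zero => rfl
    | succ m ih => rw [pow_succ, AlgEquiv.mul_apply, hx, ih]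
  have hTrL : ∀ y : L, Tr (algebraMap L F y ^ 3 + algebraMap L F y) = Tr (y ^ 3 + y) := fun y => by
    rw [← map_pow, ← map_add, Tr_algebraMap (hLF ▸ hodd)]
  let g : {y : L // Tr (y ^ 3 + y) = 0} → f.fixedPoints := fun y =>
    ⟨⟨algebraMap L F y, (hTrL y).trans y.2⟩, Subtype.ext (σ.commutes y)⟩
  have hg : Function.Bijective g := by
    constructor
    · intro y y' h
      apply Subtype.ext
      apply (algebraMap L F).injective
      exact congrArg (fun z : f.fixedPoints => (z.1.1 : F)) h
    · rintro ⟨⟨x, hx⟩, hfx⟩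
      obtain ⟨y, rfl⟩ := hfix x (congrArg Subtype.val hfx)
      exact ⟨⟨y, (hTrL y).symm.trans hx⟩, rfl⟩
  rw [← Fintype.card_of_bijective hg] at hcard
  have hq : ((Fintype.card F : ℕ) : ℤ) ≡ Fintype.card L [ZMOD p] := by
    have h := Module.card_eq_pow_finrank (K := L) (V := F)
    rw [h, hLF, ← ZMod.intCast_eq_intCast_iff]
    push_cast
    exact ZMod.pow_card _
  rw [cubicSum_one_eq_card, cubicSum_one_eq_card]
  exact ((Int.ModEq.refl 2).mul (Int.natCast_modEq_iff.2 hcard)).sub hq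

end

open scoped NumberTheorySymbols in
/-- The absolute value is known from the square. The sign is found by induction along a tower of
extensions of odd prime degree `p`: comparing both sides modulo `p` brings in the Legendre symbol
`2 ^ ((p - 1) / 2) ≡ J(2 | p)`. -/
theorem cubicSum_one {n : ℕ} (hn : Odd n) {F : Type*} [Field F] [Algebra (ZMod 2) F] [Fintype F]
    (hF : Fintype.card F = 2 ^ n) :
    cubicSum (1 : F) = J(2 | n) * 2 ^ ((n + 1) / 2) := by
  induction n using Nat.strong_induction_on generalizing F with
  | _ n ih =>
  rcases eq_or_ne n 1 with rfl | hn1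
  · classical
    have hu : (Finset.univ : Finset F) = {0, 1} := by
      symm
      apply Finset.eq_univ_of_card
      rw [Finset.card_pair zero_ne_one, hF]; rfl
    have := charP_two (F := F)
    rw [cubicSum, hu, Finset.sum_pair zero_ne_one]
    simp [CharTwo.add_self_eq_zero, chi_zero]
  obtain ⟨p, hp, k, rfl⟩ := Nat.exists_prime_and_dvd hn1
  obtain ⟨hpo, hko⟩ := Nat.odd_mul.1 hn
  have hk0 : 0 < k := hko.pos
  have := Fact.mk hp
  -- the subfield with `2 ^ k` elements
  have hfr : Module.finrank (ZMod 2) (GaloisField 2 k) ∣ Module.finrank (ZMod 2) F := by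
    rw [GaloisField.finrank 2 hk0.ne', finrank_eq hF]
    exact dvd_mul_left k p
  obtain ⟨φ⟩ := FiniteField.nonempty_algHom_of_finrank_dvd hfr
  let L := φ.fieldRange
  have hLk : Module.finrank (ZMod 2) L = k := by
    rw [← GaloisField.finrank 2 hk0.ne']
    exact (AlgEquiv.ofInjectiveField φ).toLinearEquiv.finrank_eq.symm
  have : Fintype L := Fintype.ofFinite L
  have hLcard : Fintype.card L = 2 ^ k := by
    rw [Module.card_eq_pow_finrank (K := ZMod 2) (V := L), hLk, ZMod.card]
  have hLF : Module.finrank L F = p := by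
    have h := Module.finrank_mul_finrank (ZMod 2) L F
    rw [hLk, finrank_eq hF, mul_comm] at h
    exact Nat.eq_of_mul_eq_mul_right hk0 h
  have hlt : k < p * k := by
    have := hp.two_le
    nlinarith
  have hL := ih k hlt hko hLcard
  have hmod := cubicSum_one_modEq hp hpo hLF
  have hsq := cubicSum_one_sq hn hF
  obtain ⟨l, hl⟩ := hpo
  obtain ⟨j, hj⟩ := hko
  obtain ⟨m, hm⟩ := hn
  have hml : m = l * k + j := by
    have : p * k = 2 * (l * k) + k := by rw [hl]; ring
    omega
  have hmd : (p * k + 1) / 2 = m + 1 := by omega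
  have hjd : (k + 1) / 2 = j + 1 := by omega
  have hS : cubicSum (1 : F) = 2 ^ (m + 1) ∨ cubicSum (1 : F) = -2 ^ (m + 1) := by
    rw [← sq_eq_sq_iff_eq_or_eq_neg, hsq, hm]
    ring
  have hk0' : NeZero k := ⟨hk0.ne'⟩
  have hp0' : NeZero p := ⟨hp.ne_zero⟩
  have hko : Odd k := ⟨j, hj⟩
  have hpo : Odd p := ⟨l, hl⟩
  rw [jacobiSym.mul_right, hmd]
  rw [hL, hjd] at hmod
  have hleg : (2 : ℤ) ^ l ≡ J(2 | p) [ZMOD p] := by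
    rw [← ZMod.intCast_eq_intCast_iff, ← jacobiSym.legendreSym.to_jacobiSym, legendreSym.eq_pow,
      show p / 2 = l by omega]
    push_cast
    rfl
  have hJp : J(2 | p) = 1 ∨ J(2 | p) = -1 := by
    refine (jacobiSym.eq_one_or_neg_one ?_)
    exact Int.isCoprime_iff_gcd_eq_one.1 (by exact_mod_cast (Nat.coprime_two_left.2 hpo).isCoprime)
  have hJk : J(2 | k) = 1 ∨ J(2 | k) = -1 := by
    refine (jacobiSym.eq_one_or_neg_one ?_)
    exact Int.isCoprime_iff_gcd_eq_one.1 (by exact_mod_cast (Nat.coprime_two_left.2 hko).isCoprime)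
  -- `2 ^ (m + 1) = (2 ^ l) ^ k * 2 ^ (j + 1)` is congruent to `J(2 | p) * 2 ^ (j + 1)`
  have hpow : (2 : ℤ) ^ (m + 1) ≡ J(2 | p) * 2 ^ (j + 1) [ZMOD p] := by
    have h := (hleg.pow k).mul_right (2 ^ (j + 1))
    have hJ : J(2 | p) ^ k = J(2 | p) := by
      rcases hJp with h | h <;> rw [h]
      · exact one_pow k
      · exact hko.neg_one_pow
    rw [hJ, ← pow_mul, ← pow_add] at h
    rwa [hml, add_assoc]
  have hp2 : IsCoprime (2 ^ (j + 1) : ℤ) p := by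
    apply IsCoprime.pow_left
    exact_mod_cast (Nat.coprime_two_left.2 hpo).isCoprime
  have h3 : 3 ≤ p := by have := hp.two_le; omega
  -- the two candidate values differ modulo `p`
  have hcontra : ¬ ((2 : ℤ) ^ (j + 1) ≡ -2 ^ (j + 1) [ZMOD p]) := by
    intro h
    have h1 : (p : ℤ) ∣ 2 ^ (j + 1) * 2 := by
      have := h.symm.dvd
      rwa [sub_neg_eq_add, ← mul_two] at this
    have h2 := hp2.symm.dvd_of_dvd_mul_left h1
    have := Int.le_of_dvd (by norm_num) h2
    omega
  have hpow' := hpow.neg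
  rcases hS with hS | hS <;> rcases hJp with h1 | h1 <;> rcases hJk with h2 | h2 <;>
    simp only [hS, h1, h2, mul_one, one_mul, neg_mul, mul_neg, neg_neg] at hmod hpow hpow' ⊢
  all_goals first
    | (exfalso; exact hcontra (hpow.symm.trans hmod))
    | (exfalso; exact hcontra (hpow'.symm.trans hmod))
    | (exfalso; exact hcontra (hmod.symm.trans hpow))
    | (exfalso; exact hcontra (hmod.symm.trans hpow'))

/-- The sign of `cubicSum 1` read modulo three. -/
theorem cubicSum_one_mod_three {n : ℕ} (hn : Odd n) {F : Type*} [Field F] [Algebra (ZMod 2) F]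
    [Fintype F] (hF : Fintype.card F = 2 ^ n) :
    ((n % 8 = 5 ∨ n % 8 = 7) → cubicSum (1 : F) ≡ 1 [ZMOD 3]) ∧
    ((n % 8 = 1 ∨ n % 8 = 3) → cubicSum (1 : F) ≡ -1 [ZMOD 3]) := by
  have hpow : ∀ k : ℕ, ((2 : ℤ) ^ k ≡ (-1) ^ k [ZMOD 3]) := fun k => Int.ModEq.pow k (by decide)
  rw [cubicSum_one hn hF, jacobiSym.at_two hn, ZMod.χ₈_nat_eq_if_mod_eight]
  have hn2 := Nat.odd_iff.1 hn
  constructor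
  · rintro (h | h)
    · have ho : Odd ((n + 1) / 2) := Nat.odd_iff.2 (by omega)
      have := hpow ((n + 1) / 2)
      rw [ho.neg_one_pow] at this
      simpa [h, hn2] using this.neg
    · have ho : Even ((n + 1) / 2) := Nat.even_iff.2 (by omega)
      have := hpow ((n + 1) / 2)
      rw [ho.neg_one_pow] at this
      simpa [h, hn2] using this
  · rintro (h | h)
    · have ho : Odd ((n + 1) / 2) := Nat.odd_iff.2 (by omega)
      have := hpow ((n + 1) / 2)
      rw [ho.neg_one_pow] at this
      simpa [h, hn2] using this
    · have ho : Even ((n + 1) / 2) := Nat.even_iff.2 (by omega)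
      have := hpow ((n + 1) / 2)
      rw [ho.neg_one_pow] at this
      simpa [h, hn2] using this.neg

/-! ### Combination of the two congruences -/

section
variable {F : Type*} [Field F] [Algebra (ZMod 2) F] [Fintype F]

theorem existsUnique_cube_root {n : ℕ} (hn : Odd n) (hF : Fintype.card F = 2 ^ n) (a : F) :
    ∃! c : F, c ^ 3 = a := by
  have := charP_two (F := F)
  have h2 : (2 : F) = 0 := CharTwo.two_eq_zero
  have hinj : Function.Injective fun c : F => c ^ 3 := by
    intro x y h
    by_contra hxy
    have hq : x ^ 2 + x * y + y ^ 2 = 0 := by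
      refine (mul_eq_zero.1 (?_ : (x - y) * _ = 0)).resolve_left (sub_ne_zero.2 hxy)
      simp only at h
      linear_combination h
    have hy : y ≠ 0 := by
      rintro rfl
      apply hxy
      have : x ^ 2 = 0 := by linear_combination hq
      exact (pow_eq_zero_iff two_ne_zero).1 this
    -- a primitive cube root of unity would solve `z ^ 2 + z = 1`, but `Tr 1 = 1`
    have hz : (x * y⁻¹) ^ 2 + x * y⁻¹ = 1 := by
      field_simp
      linear_combination hq - y ^ 2 * h2
    have hT := Tr_artinSchreier (x * y⁻¹)
    rw [hz, Tr_one hn hF] at hT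
    exact one_ne_zero hT
  exact (Finite.injective_iff_bijective.1 hinj).existsUnique a

theorem K_mod_sixteen {n : ℕ} (hn : 4 ≤ n) (hF : Fintype.card F = 2 ^ n) {a : F} (ha : a ≠ 0) :
    (Tr a = 0 → Q n a = 0 → K n a % 16 = 0) ∧ (Tr a = 0 → Q n a = 1 → K n a % 16 = 8) ∧
    (Tr a = 1 → Q n a = 0 → K n a % 16 = 12) ∧ (Tr a = 1 → Q n a = 1 → K n a % 16 = 4) := by
  refine ⟨fun hT hQ => ?_, fun hT hQ => ?_, fun hT hQ => ?_, fun hT hQ => ?_⟩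
  · have h := K_modEq_sixteen hn hF ha (e := 0) (by simp [hQ])
    rw [trInt_of_Tr_eq_zero hT] at h
    exact h
  · have h := K_modEq_sixteen hn hF ha (e := 1) (by simp [hQ])
    rw [trInt_of_Tr_eq_zero hT] at h
    exact h
  · have h := K_modEq_sixteen hn hF ha (e := 0) (by simp [hQ])
    rw [trInt_of_Tr_eq_one hT] at h
    exact h
  · have h := K_modEq_sixteen hn hF ha (e := 1) (by simp [hQ])
    rw [trInt_of_Tr_eq_one hT] at h
    exact h

theorem K_mod_three_of_Tr_eq_zero {n : ℕ} (hn : Odd n) (hn2 : 2 ≤ n)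
    (hF : Fintype.card F = 2 ^ n) {c : F} (hc : c ≠ 0) (hT : Tr c = 0) :
    K n (c ^ 3) % 3 = 1 := by
  have h := K_modEq_three hn hn2 hF hc
  rw [cubicSum_eq_zero hn hF hT] at h
  exact h

/-- Passing from `Tr (β ^ 3) = 0` to `Tr (β ^ 3) = 1` changes the sign of the cubic sum, as does
passing from `n` to `n + 4`. -/
theorem K_mod_three_of_quartic {n : ℕ} (hn : Odd n) (hn2 : 2 ≤ n)
    (hF : Fintype.card F = 2 ^ n) {c β : F} (hc : c ≠ 0) (hβ : Tr β = 0)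
    (hcβ : c = β ^ 4 + β + 1) :
    ((n + 4 * (Tr (β ^ 3)).val ≡ 5 [MOD 8] ∨ n + 4 * (Tr (β ^ 3)).val ≡ 7 [MOD 8]) →
      K n (c ^ 3) % 3 = 0) ∧
    ((n + 4 * (Tr (β ^ 3)).val ≡ 1 [MOD 8] ∨ n + 4 * (Tr (β ^ 3)).val ≡ 3 [MOD 8]) →
      K n (c ^ 3) % 3 = 2) := by
  have h := K_modEq_three hn hn2 hF hc
  obtain ⟨h57, h13⟩ := cubicSum_one_mod_three hn hF
  have hS : cubicSum c = chi (β ^ 3) * cubicSum (1 : F) := by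
    rw [hcβ]
    exact cubicSum_quartic hβ
  rw [hS] at h
  unfold Nat.ModEq
  unfold Int.ModEq at h h57 h13
  rcases Tr_eq_zero_or_one (β ^ 3) with ht | ht
  · rw [chi_of_Tr_eq_zero ht] at h
    rw [ht, ZMod.val_zero]
    omega
  · rw [chi_of_Tr_eq_one ht] at h
    rw [ht, ZMod.val_one]
    omega

end

end BinaryKloosterman

theorem mainTheorem2 {F : Type*} [Field F] [Fintype F] [Algebra (ZMod 2) F]
    (n : ℕ) (hn : Odd n) (hn5 : 5 ≤ n) (hF : Fintype.card F = 2 ^ n) (a : F) (ha : a ≠ 0) :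
    (BinaryKloosterman.Q n a = 0 ∨ BinaryKloosterman.Q n a = 1) ∧
    (∃! c : F, c ^ 3 = a) ∧
    ∀ c : F, c ^ 3 = a →
      (BinaryKloosterman.Tr c = 0 →
        (BinaryKloosterman.Tr a = 1 → BinaryKloosterman.Q n a = 1 →
          BinaryKloosterman.K n a ≡ 4 [ZMOD 48]) ∧
        (BinaryKloosterman.Tr a = 0 → BinaryKloosterman.Q n a = 0 →
          BinaryKloosterman.K n a ≡ 16 [ZMOD 48]) ∧
        (BinaryKloosterman.Tr a = 1 → BinaryKloosterman.Q n a = 0 →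
          BinaryKloosterman.K n a ≡ 28 [ZMOD 48]) ∧
        (BinaryKloosterman.Tr a = 0 → BinaryKloosterman.Q n a = 1 →
          BinaryKloosterman.K n a ≡ 40 [ZMOD 48])) ∧
      (BinaryKloosterman.Tr c = 1 →
        (∃! β : F, BinaryKloosterman.Tr β = 0 ∧ c = β ^ 4 + β + 1) ∧
        ∀ β : F, BinaryKloosterman.Tr β = 0 → c = β ^ 4 + β + 1 →
          ((n + 4 * (BinaryKloosterman.Tr (β ^ 3)).val ≡ 5 [MOD 8] ∨
              n + 4 * (BinaryKloosterman.Tr (β ^ 3)).val ≡ 7 [MOD 8]) →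
            (BinaryKloosterman.Tr a = 0 → BinaryKloosterman.Q n a = 0 →
              BinaryKloosterman.K n a ≡ 0 [ZMOD 48]) ∧
            (BinaryKloosterman.Tr a = 1 → BinaryKloosterman.Q n a = 0 →
              BinaryKloosterman.K n a ≡ 12 [ZMOD 48]) ∧
            (BinaryKloosterman.Tr a = 0 → BinaryKloosterman.Q n a = 1 →
              BinaryKloosterman.K n a ≡ 24 [ZMOD 48]) ∧
            (BinaryKloosterman.Tr a = 1 → BinaryKloosterman.Q n a = 1 →
              BinaryKloosterman.K n a ≡ 36 [ZMOD 48])) ∧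
          ((n + 4 * (BinaryKloosterman.Tr (β ^ 3)).val ≡ 1 [MOD 8] ∨
              n + 4 * (BinaryKloosterman.Tr (β ^ 3)).val ≡ 3 [MOD 8]) →
            (BinaryKloosterman.Tr a = 0 → BinaryKloosterman.Q n a = 1 →
              BinaryKloosterman.K n a ≡ 8 [ZMOD 48]) ∧
            (BinaryKloosterman.Tr a = 1 → BinaryKloosterman.Q n a = 1 →
              BinaryKloosterman.K n a ≡ 20 [ZMOD 48]) ∧
            (BinaryKloosterman.Tr a = 0 → BinaryKloosterman.Q n a = 0 →
              BinaryKloosterman.K n a ≡ 32 [ZMOD 48]) ∧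
            (BinaryKloosterman.Tr a = 1 → BinaryKloosterman.Q n a = 0 →
              BinaryKloosterman.K n a ≡ 44 [ZMOD 48]))) := by
  open BinaryKloosterman in
  refine ⟨Q_eq_zero_or_one hF a, existsUnique_cube_root hn hF a, ?_⟩
  rintro c rfl
  have hc : c ≠ 0 := fun h => ha (by rw [h]; ring)
  obtain ⟨h00, h01, h10, h11⟩ := K_mod_sixteen (by omega) hF ha
  constructor
  · intro hT
    have h3 := K_mod_three_of_Tr_eq_zero hn (by omega) hF hc hT
    refine ⟨fun hA hQ => ?_, fun hA hQ => ?_, fun hA hQ => ?_, fun hA hQ => ?_⟩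
    · have h16 := h11 hA hQ
      unfold Int.ModEq; omega
    · have h16 := h00 hA hQ
      unfold Int.ModEq; omega
    · have h16 := h10 hA hQ
      unfold Int.ModEq; omega
    · have h16 := h01 hA hQ
      unfold Int.ModEq; omega
  · intro hT
    refine ⟨existsUnique_quartic hn hF hT, fun β hβ hcβ => ?_⟩
    obtain ⟨h57, h13⟩ := K_mod_three_of_quartic hn (by omega) hF hc hβ hcβ
    refine ⟨fun hm => ?_, fun hm => ?_⟩
    · have h3 := h57 hm
      refine ⟨fun hA hQ => ?_, fun hA hQ => ?_, fun hA hQ => ?_, fun hA hQ => ?_⟩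
      · have h16 := h00 hA hQ
        unfold Int.ModEq; omega
      · have h16 := h10 hA hQ
        unfold Int.ModEq; omega
      · have h16 := h01 hA hQ
        unfold Int.ModEq; omega
      · have h16 := h11 hA hQ
        unfold Int.ModEq; omega
    · have h3 := h13 hm
      refine ⟨fun hA hQ => ?_, fun hA hQ => ?_, fun hA hQ => ?_, fun hA hQ => ?_⟩
      · have h16 := h01 hA hQ
        unfold Int.ModEq; omega
      · have h16 := h11 hA hQ
        unfold Int.ModEq; omega
      · have h16 := h00 hA hQ
        unfold Int.ModEq; omega
      · have h16 := h10 hA hQ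
        unfold Int.ModEq; omega
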